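/- Let $q$ be a prime power, $n\ge 0$ an integer, $V=\mathbb{F}_q^n$, and let $G$ be $\mathrm{GL}(V)$ or $\mathrm{PGL}(V)=\mathrm{GL}(V)/Z(\mathrm{GL}(V))$, acting naturally on the lattice of subspaces of $V$. For a subgroup $H\le G$ let $\mathcal{S}(V,H)$ be the lattice of $H$-invariant subspaces of $V$, that is, of all subspaces $W\le V$ that are mapped onto themselves by every element of $H$. Call $H$ closed in $G$ if $H=\bigcap_{W\in\mathcal{S}(V,H)}\mathrm{stab}_G(W)$, i.e. if $H$ consists of all elements of $G$ that stabilize every $H$-invariant subspace. For $m\in\mathbb{N}$ let $c(m)$ be the number of closed subgroups $H$ of $G$ with $|G:H|=m$ for which $\mathcal{S}(V,H)$ is isomorphic, as a lattice, to a direct product of finitely many finite (non-empty) chains. Then there is an absolute constant $\alpha$, independent of $n$ and $q$ and the same for $\mathrm{GL}(V)$ and $\mathrm{PGL}(V)$, such that $c(m)\le m^{\alpha}$ for every $m\in\mathbb{N}$; moreover $\alpha$ can be chosen with $\alpha\le 12$. -/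

import Mathlib

open scoped MatrixGroups

namespace ClosedSubgroups

/-- The natural action of `GL(n, F)` on the subspace lattice of `V = F ^ n`, as a homomorphism
to the group of lattice automorphisms: `g` sends `W` to its image under `v ↦ g *ᵥ v`. -/
def glAct (n : ℕ) (F : Type*) [Field F] :
    GL (Fin n) F →* (Submodule F (Fin n → F) ≃o Submodule F (Fin n → F)) where
  toFun g := Submodule.orderIsoMapComap (Matrix.GeneralLinearGroup.toLin g).toLinearEquiv
  map_one' := by
    refine RelIso.ext fun W => SetLike.coe_injective ?_
    simp
  map_mul' g h := by
    refine RelIso.ext fun W => SetLike.coe_injective ?_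
    simp only [RelIso.mul_apply, Submodule.orderIsoMapComap_apply, Submodule.map_coe,
      Set.image_image, map_mul]
    rfl

theorem mem_glAct {n : ℕ} {F : Type*} [Field F] (g : GL (Fin n) F)
    (W : Submodule F (Fin n → F)) (v : Fin n → F) :
    v ∈ glAct n F g W ↔ ∃ w ∈ W, g.val.mulVec w = v := Iff.rfl

theorem glAct_scalar {n : ℕ} {F : Type*} [Field F] (u : Fˣ) :
    glAct n F (Matrix.GeneralLinearGroup.scalar (Fin n) u) = 1 := by
  ext W v
  rw [mem_glAct]
  have h : ∀ w : Fin n → F,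
      (Matrix.GeneralLinearGroup.scalar (Fin n) u).val.mulVec w = (u : F) • w := by
    intro w
    ext i
    simp [Matrix.mulVec_diagonal]
  simp only [h, RelIso.one_apply]
  constructor
  · rintro ⟨w, hw, rfl⟩
    exact W.smul_mem _ hw
  · intro hv
    exact ⟨(u⁻¹ : Fˣ).val • v, W.smul_mem _ hv, by simp⟩

/-- The natural action of `PGL(n, F)` on the subspace lattice of `V = F ^ n`, induced by the
action of `GL(n, F)`. -/
def pglAct (n : ℕ) (F : Type*) [Field F] :
    PGL(n, F) →* (Submodule F (Fin n → F) ≃o Submodule F (Fin n → F)) :=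
  Matrix.ProjGenLinGroup.lift (glAct n F) (MonoidHom.ext glAct_scalar)

theorem pglAct_mk {n : ℕ} {F : Type*} [Field F] (g : GL (Fin n) F) :
    pglAct n F (Matrix.ProjGenLinGroup.mk g) = glAct n F g := rfl

section Action

variable {G L : Type*} [Group G] [Lattice L] (ρ : G →* (L ≃o L))

/-- The sublattice of elements of `L` fixed by every element of `H`. For the action on the
subspace lattice of `V` this is the lattice `S(V, H)` of `H`-invariant subspaces. -/
def invariants (H : Subgroup G) : Sublattice L where
  carrier := {W | ∀ h ∈ H, ρ h W = W}
  supClosed' := fun a ha b hb h hh => by rw [map_sup, ha h hh, hb h hh]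
  infClosed' := fun a ha b hb h hh => by rw [map_inf, ha h hh, hb h hh]

/-- The stabilizer in `G` of an element of `L`. -/
def stab (W : L) : Subgroup G where
  carrier := {g | ρ g W = W}
  one_mem' := by simp
  mul_mem' := fun {a b} (ha : ρ a W = W) (hb : ρ b W = W) =>
    show ρ (a * b) W = W by rw [map_mul, RelIso.mul_apply, hb, ha]
  inv_mem' := fun {a} (ha : ρ a W = W) => show ρ a⁻¹ W = W by
    rw [map_inv]
    nth_rw 1 [← ha]
    exact RelIso.inv_apply_self _ _

/-- The closure `cl(H)`: the intersection of the stabilizers of all `H`-invariant elements. -/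
def cl (H : Subgroup G) : Subgroup G :=
  ⨅ W ∈ invariants ρ H, stab ρ W

/-- `H` is closed in `G`. -/
def IsClosedSubgroup (H : Subgroup G) : Prop := cl ρ H = H

/-- The set of closed subgroups of `G` of index `m` whose invariant lattice is isomorphic to
a product of finite chains. -/
def closedProductOfChains (m : ℕ) : Set (Subgroup G) :=
  {H | IsClosedSubgroup ρ H ∧ H.index = m ∧
    ∃ (r : ℕ) (ℓ : Fin r → ℕ), Nonempty (invariants ρ H ≃o ((i : Fin r) → Fin (ℓ i + 1)))}

/-- The number `c(m)` of these subgroups, for a finite group `G`. -/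
noncomputable def c (m : ℕ) : ℕ := (closedProductOfChains ρ m).ncard

/-- The set counted by `c(m)` is finite when `G` is finite, so that `c(m)` is its cardinality. -/
theorem closedProductOfChains_finite [Finite G] (m : ℕ) :
    (closedProductOfChains ρ m).Finite := Set.toFinite _

end Action

theorem finite_GL (n : ℕ) (F : Type*) [Field F] [Finite F] : Finite (GL (Fin n) F) :=
  inferInstance

theorem finite_PGL (n : ℕ) (F : Type*) [Field F] [Finite F] : Finite (PGL(n, F)) :=
  Finite.of_surjective _ Matrix.ProjGenLinGroup.mk_surjective

end ClosedSubgroups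

namespace ClosedSubgroups

open Module

/-! ### Bases adapted to products of chains of subspaces. -/

section Adapted

variable {F V : Type*} [Field F] [AddCommGroup V] [Module F V]

/-! A closed subgroup is determined by its invariant lattice. If that lattice is a product of
chains, it has an adapted basis (`exists_adapted_basis`), so the dimensions of the steps in each
chain determine it up to `GL(V)`, and closed subgroups with the same data are conjugate. A subgroup
of index `m` has at most `m` conjugates, so `c(m)` is at most `m` times the number of possible data.
The data amount to a composition of `n` with its blocks grouped into chains, at most `4 ^ (n - 1)`
choices. A proper closed subgroup fixes a nontrivial proper subspace, whose orbit has at least `2 ^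
(n - 1)` elements (`two_pow_le_index`), so there are at most `m ^ 2` data. Hence `c(m) ≤ m ^ 3` for
`GL`; the bound passes to `PGL` by taking preimages. -/

theorem exists_sup_span_range_eq [FiniteDimensional F V] {A B : Submodule F V} (hAB : A ≤ B) {d : ℕ}
    (hd : finrank F A + d = finrank F B) :
    ∃ v : Fin d → V, B = A ⊔ Submodule.span F (Set.range v) := by
  obtain ⟨U, hU⟩ := Submodule.exists_isCompl A
  have hsup : A ⊔ U ⊓ B = B := by
    rw [← sup_inf_assoc_of_le U hAB, hU.sup_eq_top, top_inf_eq]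
  have hinf : A ⊓ (U ⊓ B) = ⊥ := by
    rw [← inf_assoc, hU.inf_eq_bot, bot_inf_eq]
  have hfr : finrank F (U ⊓ B : Submodule F V) = d := by
    have := Submodule.finrank_sup_add_finrank_inf_eq A (U ⊓ B)
    rw [hsup, hinf, finrank_bot] at this
    omega
  let b := finBasisOfFinrankEq F (U ⊓ B : Submodule F V) hfr
  refine ⟨fun j => (b j : V), ?_⟩
  have : Set.range (fun j => (b j : V)) = (U ⊓ B).subtype '' Set.range b := by
    rw [← Set.range_comp]; rfl
  rw [this, Submodule.span_image, b.span_eq, Submodule.map_top, Submodule.range_subtype, hsup]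

variable {ι : Type*} [DecidableEq ι] {ℓ : ι → ℕ}

theorem disjoint_update_bot {i j : ι} (h : i ≠ j) (a : Fin (ℓ i + 1)) (b : Fin (ℓ j + 1)) :
    Disjoint (Function.update (⊥ : (i : ι) → Fin (ℓ i + 1)) i a) (Function.update ⊥ j b) := by
  rw [disjoint_iff]
  ext k : 1
  rw [Pi.inf_apply, Pi.bot_apply]
  by_cases hk : k = i
  · subst hk
    rw [Function.update_of_ne h, Pi.bot_apply, inf_bot_eq]
  · rw [Function.update_of_ne hk, Pi.bot_apply, bot_inf_eq]

variable (ψ : BoundedLatticeHom ((i : ι) → Fin (ℓ i + 1)) (Submodule F V))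
  {d : (i : ι) → Fin (ℓ i) → ℕ}

theorem finrank_update_eq_sum
    (hd : ∀ i j, finrank F (ψ (Function.update ⊥ i j.castSucc)) + d i j =
      finrank F (ψ (Function.update ⊥ i j.succ))) (i : ι) :
    finrank F (ψ (Function.update ⊥ i ⊤)) = ∑ j, d i j := by
  have h0 : finrank F (ψ (Function.update ⊥ i (0 : Fin (ℓ i + 1)))) = 0 := by
    have : Function.update (⊥ : (i : ι) → Fin (ℓ i + 1)) i 0 = ⊥ :=
      Function.update_eq_self i (⊥ : (i : ι) → Fin (ℓ i + 1))
    rw [this, map_bot, finrank_bot]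
  have key : ∀ (N : ℕ) (f : Fin (N + 1) → ℕ) (e : Fin N → ℕ), f 0 = 0 →
      (∀ j, f j.castSucc + e j = f j.succ) → f (Fin.last N) = ∑ j, e j := by
    intro N
    induction N with
    | zero => intro f e h _; simpa using h
    | succ N ih =>
      intro f e h hs
      rw [Fin.sum_univ_castSucc, ← ih (fun k => f k.castSucc) (fun k => e k.castSucc) h
        (fun j => hs j.castSucc), hs, Fin.succ_last]
  exact key _ (fun k => finrank F (ψ (Function.update ⊥ i k))) _ h0 (hd i)

variable [Fintype ι]

theorem sup_update_bot (x : (i : ι) → Fin (ℓ i + 1)) :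
    Finset.univ.sup (fun i => Function.update (⊥ : (i : ι) → Fin (ℓ i + 1)) i (x i)) = x := by
  apply le_antisymm
  · refine Finset.sup_le fun i _ k => ?_
    by_cases hk : k = i
    · subst hk; simp
    · rw [Function.update_of_ne hk]; exact bot_le
  · intro k
    have := Finset.le_sup (f := fun i => Function.update (⊥ : (i : ι) → Fin (ℓ i + 1)) i (x i))
      (Finset.mem_univ k) k
    simpa using this

variable [FiniteDimensional F V]

/-- Elements supported on disjoint sets of coordinates meet in `⊥`, so the images of the coordinate
chains form a direct sum. -/
theorem finrank_eq_sum_update (x : (i : ι) → Fin (ℓ i + 1)) :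
    finrank F (ψ x) = ∑ i, finrank F (ψ (Function.update ⊥ i (x i))) := by
  have key : ∀ t : Finset ι,
      finrank F (ψ (t.sup fun i => Function.update ⊥ i (x i))) =
        ∑ i ∈ t, finrank F (ψ (Function.update ⊥ i (x i))) := by
    intro t
    induction t using Finset.induction_on with
    | empty => rw [Finset.sup_empty, map_bot, finrank_bot, Finset.sum_empty]
    | insert i t hi ih =>
      rw [Finset.sup_insert, Finset.sum_insert hi, ← ih, map_sup,
        ← Submodule.finrank_sup_add_finrank_inf_eq, ← map_inf]
      have : Disjoint (Function.update ⊥ i (x i)) (t.sup fun i => Function.update ⊥ i (x i)) :=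
        Finset.disjoint_sup_right.2 fun j hj =>
          disjoint_update_bot (fun h : i = j => hi (h ▸ hj)) _ _
      rw [this.eq_bot, map_bot, finrank_bot, add_zero]
  rw [← key, sup_update_bot]

theorem finrank_eq_sum_sum
    (hd : ∀ i j, finrank F (ψ (Function.update ⊥ i j.castSucc)) + d i j =
      finrank F (ψ (Function.update ⊥ i j.succ))) :
    finrank F V = ∑ i, ∑ j, d i j := by
  rw [← finrank_top, ← map_top ψ, finrank_eq_sum_update]
  exact Finset.sum_congr rfl fun i _ => finrank_update_eq_sum ψ hd i

/-- A bounded lattice homomorphism from a product of chains to a subspace lattice is described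
by a basis indexed by the steps of the chains. -/
theorem exists_adapted_basis
    (hd : ∀ i j, finrank F (ψ (Function.update ⊥ i j.castSucc)) + d i j =
      finrank F (ψ (Function.update ⊥ i j.succ))) :
    ∃ b : Basis (Σ i, Σ j, Fin (d i j)) F V,
      ∀ x, ψ x = Submodule.span F (b '' {t | t.2.1.castSucc < x t.1}) := by
  have hle : ∀ i (j : Fin (ℓ i)),
      ψ (Function.update ⊥ i j.castSucc) ≤ ψ (Function.update ⊥ i j.succ) := fun i j =>
    OrderHomClass.mono ψ (update_le_update_iff.2
      ⟨(Fin.castSucc_lt_succ).le, fun _ _ => le_rfl⟩)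
  choose v hv using fun i j => exists_sup_span_range_eq (hle i j) (hd i j)
  let w : (Σ i, Σ j, Fin (d i j)) → V := fun t => v t.1 t.2.1 t.2.2
  have hchain : ∀ i (k : Fin (ℓ i + 1)), ψ (Function.update ⊥ i k) =
      Submodule.span F (w '' {t | t.1 = i ∧ (t.2.1 : ℕ) < k}) := by
    intro i k
    induction k using Fin.induction with
    | zero =>
      have : Function.update (⊥ : (i : ι) → Fin (ℓ i + 1)) i 0 = ⊥ :=
        Function.update_eq_self i (⊥ : (i : ι) → Fin (ℓ i + 1))
      rw [this, map_bot]
      simp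
    | succ k ih =>
      rw [hv, ih, ← Submodule.span_union]
      congr 1
      ext y
      simp only [Set.mem_union, Set.mem_image, Set.mem_ofPred_eq, Set.mem_range, Fin.val_succ,
        Fin.val_castSucc]
      constructor
      · rintro (⟨t, ⟨h1, h2⟩, rfl⟩ | ⟨s, rfl⟩)
        · exact ⟨t, ⟨h1, by omega⟩, rfl⟩
        · exact ⟨⟨i, k, s⟩, ⟨rfl, by simp⟩, rfl⟩
      · rintro ⟨⟨i', j, s⟩, ⟨h1, h2⟩, rfl⟩
        obtain rfl : i' = i := h1
        rcases Nat.lt_succ_iff_lt_or_eq.1 h2 with h | h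
        · exact Or.inl ⟨⟨i', j, s⟩, ⟨rfl, h⟩, rfl⟩
        · obtain rfl : j = k := Fin.ext h
          exact Or.inr ⟨s, rfl⟩
  have hall : ∀ x, ψ x = Submodule.span F (w '' {t | t.2.1.castSucc < x t.1}) := by
    intro x
    conv_lhs => rw [← sup_update_bot x, map_finset_sup]
    rw [Finset.sup_univ_eq_iSup]
    change (⨆ i, ψ (Function.update ⊥ i (x i))) = _
    simp_rw [hchain]
    rw [← Submodule.span_iUnion, ← Set.image_iUnion]
    congr 2
    ext t
    simp [Fin.lt_def]
  have htop : ⊤ ≤ Submodule.span F (Set.range w) := by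
    rw [← map_top ψ, hall]
    exact Submodule.span_mono (Set.image_subset_range _ _)
  -- Independence comes from counting: a spanning family of size `dim V` is a basis.
  have hcard : Fintype.card (Σ i, Σ j, Fin (d i j)) = finrank F V := by
    simp [finrank_eq_sum_sum ψ hd]
  refine ⟨basisOfTopLeSpanOfCardEqFinrank w htop hcard, ?_⟩
  rw [coe_basisOfTopLeSpanOfCardEqFinrank]
  exact hall

theorem exists_linearEquiv_map_eq (ψ' : BoundedLatticeHom ((i : ι) → Fin (ℓ i + 1)) (Submodule F V))
    (hd : ∀ i j, finrank F (ψ (Function.update ⊥ i j.castSucc)) + d i j =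
      finrank F (ψ (Function.update ⊥ i j.succ)))
    (hd' : ∀ i j, finrank F (ψ' (Function.update ⊥ i j.castSucc)) + d i j =
      finrank F (ψ' (Function.update ⊥ i j.succ))) :
    ∃ e : V ≃ₗ[F] V, ∀ x, (ψ x).map (e : V →ₗ[F] V) = ψ' x := by
  obtain ⟨b, hb⟩ := exists_adapted_basis ψ hd
  obtain ⟨b', hb'⟩ := exists_adapted_basis ψ' hd'
  refine ⟨b.equiv b' (Equiv.refl _), fun x => ?_⟩
  rw [hb, hb', Submodule.map_span, ← Set.image_comp]
  congr 2
  ext t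
  simp

end Adapted

/-! ### Counting the combinatorial types. -/

section Count

/-- The combinatorial types of products of chains with weighted steps. -/
abbrev ChainData := Σ r : ℕ, Fin r → Σ k : ℕ, Fin k → ℕ

/-- The list of the lists of step weights of the chains. -/
def ChainData.toLists (D : ChainData) : List (List ℕ) :=
  List.ofFn fun i => List.ofFn (D.2 i).2

theorem ChainData.toLists_injective : Function.Injective ChainData.toLists := by
  rintro ⟨r, f⟩ ⟨r', f'⟩ h
  have h := List.ofFn_inj'.1 h
  obtain rfl : r = r' := congrArg Sigma.fst h
  have h2 := eq_of_heq (Sigma.mk.inj h).2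
  have : f = f' := funext fun i => by
    simpa using List.ofFn_inj'.1 (congrFun h2 i)
  rw [this]

theorem ChainData.sum_flatten_toLists (D : ChainData) :
    D.toLists.flatten.sum = ∑ i, ∑ j, (D.2 i).2 j := by
  simp [ChainData.toLists, List.sum_flatten, List.map_ofFn, List.sum_ofFn]

/-- Codes for the types of total weight `n`. -/
abbrev ChainCode (n : ℕ) := Σ c : Composition n, Composition c.length

/-- The first composition lists all step weights, the second the lengths of the chains they are cut
into; each has at most `2 ^ (n - 1)` values. -/
theorem card_chainCode_le (n : ℕ) : Fintype.card (ChainCode n) ≤ 4 ^ (n - 1) := by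
  rw [Fintype.card_sigma]
  calc ∑ c : Composition n, Fintype.card (Composition c.length)
      ≤ ∑ _c : Composition n, 2 ^ (n - 1) := Finset.sum_le_sum fun c _ => by
        rw [composition_card]
        exact Nat.pow_le_pow_right two_pos (Nat.sub_le_sub_right c.length_le 1)
    _ = 4 ^ (n - 1) := by
        rw [Finset.sum_const, Finset.card_univ, composition_card, smul_eq_mul, ← mul_pow]
        norm_num

/-- `t` encodes the type `D`. -/
def ChainCode.Encodes {n : ℕ} (t : ChainCode n) (D : ChainData) : Prop :=
  D.toLists.flatten = t.1.blocks ∧ D.toLists.map List.length = t.2.blocks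

theorem ChainCode.Encodes.unique {n : ℕ} {t : ChainCode n} {D D' : ChainData}
    (h : t.Encodes D) (h' : t.Encodes D') : D = D' :=
  ChainData.toLists_injective
    (List.eq_iff_flatten_eq.2 ⟨h.1.trans h'.1.symm, h.2.trans h'.2.symm⟩)

theorem exists_encodes {n : ℕ} (D : ChainData) (hsum : ∑ i, ∑ j, (D.2 i).2 j = n)
    (hlen : ∀ i, 0 < (D.2 i).1) (hpos : ∀ i j, 0 < (D.2 i).2 j) :
    ∃ t : ChainCode n, t.Encodes D := by
  let c : Composition n :=
    { blocks := D.toLists.flatten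
      blocks_pos := by
        intro k hk
        simp only [ChainData.toLists, List.mem_flatten, List.mem_ofFn] at hk
        obtain ⟨_, ⟨i, rfl⟩, hk⟩ := hk
        obtain ⟨j, rfl⟩ := List.mem_ofFn.1 hk
        exact hpos i j
      blocks_sum := by rw [D.sum_flatten_toLists, hsum] }
  refine ⟨⟨c, { blocks := D.toLists.map List.length
                blocks_pos := ?_
                blocks_sum := List.length_flatten.symm }⟩, rfl, rfl⟩
  intro k hk
  simp only [ChainData.toLists, List.mem_map, List.mem_ofFn] at hk
  obtain ⟨_, ⟨i, rfl⟩, rfl⟩ := hk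
  rw [List.length_ofFn]
  exact hlen i

/-- Trivial factors may be dropped from a product of chains. -/
theorem exists_orderIso_pos {r : ℕ} (ℓ : Fin r → ℕ) :
    ∃ (r' : ℕ) (ℓ' : Fin r' → ℕ), (∀ i, 0 < ℓ' i) ∧
      Nonempty (((i : Fin r) → Fin (ℓ i + 1)) ≃o ((i : Fin r') → Fin (ℓ' i + 1))) := by
  let e := Fintype.equivFin {i // 0 < ℓ i}
  refine ⟨_, fun k => ℓ (e.symm k), fun k => (e.symm k).2, ⟨?_⟩⟩
  let f : ((i : Fin r) → Fin (ℓ i + 1)) ↪o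
      ((k : Fin (Fintype.card {i // 0 < ℓ i})) → Fin (ℓ (e.symm k) + 1)) :=
    OrderEmbedding.ofMapLEIff (fun x k => x (e.symm k)) fun x y => by
      refine ⟨fun h i => ?_, fun h k => h _⟩
      rcases Nat.eq_zero_or_pos (ℓ i) with hi | hi
      · have := (x i).2
        rw [Fin.le_def]
        omega
      · have : x (e.symm (e ⟨i, hi⟩)) ≤ y (e.symm (e ⟨i, hi⟩)) := h (e ⟨i, hi⟩)
        rwa [e.symm_apply_apply] at this
  refine RelIso.ofSurjective f fun y => ?_
  refine ⟨fun i => if hi : 0 < ℓ i then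
    (Fin.cast (by simp) (y (e ⟨i, hi⟩)) : Fin (ℓ i + 1)) else 0, ?_⟩
  funext k
  change (if hi : 0 < ℓ (e.symm k) then _ else _) = _
  rw [dif_pos (e.symm k).2]
  ext
  simp only [Fin.val_cast]
  congr 2 <;> simp

end Count

/-! ### Conjugates and quotients. -/

section Conjugates

/-- The conjugate of `H` by `g` depends only on the coset `gH`. -/
theorem ncard_conjugates_le_index {G : Type*} [Group G] [Finite G] (H : Subgroup G)
    (S : Set (Subgroup G)) (hS : ∀ K ∈ S, ∃ g : G, H.map (MulAut.conj g).toMonoidHom = K) :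
    S.ncard ≤ H.index := by
  choose! g hg using hS
  rw [Subgroup.index_eq_card, ← Set.ncard_univ]
  refine Set.ncard_le_ncard_of_injOn (fun K => (g K : G ⧸ H)) (fun _ _ => Set.mem_univ _) ?_
    (Set.toFinite _)
  intro K hK K' hK' h
  rw [← hg K hK, ← hg K' hK']
  have hmem : (g K)⁻¹ * g K' ∈ H := QuotientGroup.eq.1 h
  have hgk : g K' = g K * ((g K)⁻¹ * g K') := by group
  rw [hgk]
  generalize (g K)⁻¹ * g K' = h at hmem
  ext x
  simp only [Subgroup.mem_map, MulEquiv.coe_toMonoidHom, MulAut.conj_apply]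
  constructor
  · rintro ⟨y, hy, rfl⟩
    exact ⟨h⁻¹ * y * h, H.mul_mem (H.mul_mem (H.inv_mem hmem) hy) hmem, by group⟩
  · rintro ⟨y, hy, rfl⟩
    exact ⟨h * y * h⁻¹, H.mul_mem (H.mul_mem hmem hy) (H.inv_mem hmem), by group⟩

variable {G L : Type*} [Group G] [Lattice L] (ρ : G →* (L ≃o L))

theorem IsClosedSubgroup.mem_iff {H : Subgroup G} (hH : IsClosedSubgroup ρ H) (g : G) :
    g ∈ H ↔ ∀ W ∈ invariants ρ H, ρ g W = W := by
  have h : g ∈ cl ρ H ↔ ∀ W ∈ invariants ρ H, ρ g W = W := by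
    simp only [cl, Subgroup.mem_iInf]
    rfl
  rw [← h, hH]

theorem IsClosedSubgroup.map_conj_eq {H K : Subgroup G} (hH : IsClosedSubgroup ρ H)
    (hK : IsClosedSubgroup ρ K) (g : G)
    (h : ∀ W, W ∈ invariants ρ H ↔ ρ g W ∈ invariants ρ K) :
    H.map (MulAut.conj g).toMonoidHom = K := by
  ext x
  simp only [Subgroup.mem_map, MulEquiv.coe_toMonoidHom, MulAut.conj_apply]
  have key : ∀ y, y ∈ H ↔ g * y * g⁻¹ ∈ K := by
    intro y
    rw [hH.mem_iff, hK.mem_iff]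
    have hy : ∀ W, ρ (g * y * g⁻¹) (ρ g W) = ρ g W ↔ ρ y W = W := fun W => by
      rw [← RelIso.mul_apply, ← map_mul, inv_mul_cancel_right, map_mul, RelIso.mul_apply,
        (ρ g).injective.eq_iff]
    constructor
    · intro hy1 W hW
      obtain ⟨W, rfl⟩ := (ρ g).surjective W
      exact (hy W).2 (hy1 W ((h W).2 hW))
    · intro hy1 W hW
      exact (hy W).1 (hy1 _ ((h W).1 hW))
  constructor
  · rintro ⟨y, hy, rfl⟩
    exact (key y).1 hy
  · intro hx
    refine ⟨g⁻¹ * x * g, (key _).2 ?_, by group⟩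
    convert hx using 1
    group

/-- Taking preimages under `π` is injective and preserves the index, the invariant lattice and
closedness. -/
theorem c_le_of_comp {G' : Type*} [Group G'] [Finite G] (π : G →* G')
    (hπ : Function.Surjective π) (ρ' : G' →* (L ≃o L)) (h : ∀ g, ρ' (π g) = ρ g) (m : ℕ) :
    c ρ' m ≤ c ρ m := by
  have hinv : ∀ H : Subgroup G', invariants ρ (H.comap π) = invariants ρ' H := by
    intro H
    refine SetLike.ext fun W => ?_
    constructor
    · intro hW g hg
      obtain ⟨g, rfl⟩ := hπ g
      rw [h]
      exact hW g hg
    · intro hW g hg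
      rw [← h]
      exact hW _ hg
  refine Set.ncard_le_ncard_of_injOn (fun H => H.comap π) ?_
    (Subgroup.comap_injective hπ).injOn (Set.toFinite _)
  rintro H ⟨hcl, hidx, hchain⟩
  refine ⟨?_, ?_, ?_⟩
  · ext g
    simp only [cl, Subgroup.mem_iInf, hinv]
    rw [Subgroup.mem_comap, hcl.mem_iff]
    refine forall₂_congr fun W _ => ?_
    rw [h]
    rfl
  · rw [Subgroup.index_comap_of_surjective H hπ, hidx]
  · rw [hinv]
    exact hchain

end Conjugates

/-! ### Shears and large orbits of subspaces. -/

section Index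

variable {F V : Type*} [Field F] [AddCommGroup V] [Module F V]

/-- The shear along a map from a submodule to a complement. -/
noncomputable def shear {W U : Submodule F V} (h : IsCompl W U) (f : W →ₗ[F] U) : V ≃ₗ[F] V :=
  (Submodule.prodEquivOfIsCompl W U h).symm.trans
    ((LinearEquiv.refl F W).skewProd (LinearEquiv.refl F U) f |>.trans
      (Submodule.prodEquivOfIsCompl W U h))

theorem shear_apply {W U : Submodule F V} (h : IsCompl W U) (f : W →ₗ[F] U) (w : W) :
    shear h f w = (w : V) + f w := by
  simp [shear]

/-- The image of `W` is the graph of `f`, which determines `f`. -/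
theorem map_shear_injective {W U : Submodule F V} (h : IsCompl W U) :
    Function.Injective fun f : W →ₗ[F] U => W.map (shear h f : V →ₗ[F] V) := by
  intro f f' hff
  ext w
  have hw : shear h f w ∈ W.map (shear h f' : V →ₗ[F] V) := by
    have hff : W.map (shear h f : V →ₗ[F] V) = W.map (shear h f' : V →ₗ[F] V) := hff
    rw [← hff]
    exact Submodule.mem_map_of_mem w.2
  obtain ⟨w', he⟩ : ∃ w' : W, shear h f' w' = shear h f w := by
    obtain ⟨w', hw', he⟩ := hw
    exact ⟨⟨w', hw'⟩, he⟩
  rw [shear_apply, shear_apply] at he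
  have he' := congrArg (Submodule.prodEquivOfIsCompl W U h).symm he
  simp only [map_add, Submodule.prodEquivOfIsCompl_symm_apply_left,
    Submodule.prodEquivOfIsCompl_symm_apply_right, Prod.mk_add_mk, add_zero, zero_add,
    Prod.mk.injEq] at he'
  rw [← he'.2, he'.1]

end Index

/-! ### Bounds for `GL`. -/

variable {F : Type*} [Field F] {n : ℕ}

theorem exists_glAct_eq_map (e : (Fin n → F) ≃ₗ[F] (Fin n → F)) :
    ∃ g : GL (Fin n) F, ∀ W, glAct n F g W = W.map (e : (Fin n → F) →ₗ[F] (Fin n → F)) := by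
  refine ⟨Matrix.GeneralLinearGroup.toLin.symm (LinearMap.GeneralLinearGroup.ofLinearEquiv e),
    fun W => ?_⟩
  change W.map ((Matrix.GeneralLinearGroup.toLin (Matrix.GeneralLinearGroup.toLin.symm
    (LinearMap.GeneralLinearGroup.ofLinearEquiv e))).toLinearEquiv :
      (Fin n → F) →ₗ[F] (Fin n → F)) = _
  rw [MulEquiv.apply_symm_apply]
  rfl

/-- Shears move `W` to `|F| ^ (ab)` distinct graphs, with `a = dim W`, `b = n - a`, and `ab ≥ a + b
- 1` for `a, b ≥ 1`. -/
theorem two_pow_le_index [Finite F] {H : Subgroup (GL (Fin n) F)} {W : Submodule F (Fin n → F)}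
    (hW : W ∈ invariants (glAct n F) H) (hbot : W ≠ ⊥) (htop : W ≠ ⊤) :
    2 ^ (n - 1) ≤ H.index := by
  obtain ⟨U, hU⟩ := Submodule.exists_isCompl W
  choose g hg using fun f : W →ₗ[F] U => exists_glAct_eq_map (shear hU f)
  have hinj : Function.Injective fun f => (g f : GL (Fin n) F ⧸ H) := by
    intro f f' h
    refine map_shear_injective hU ?_
    change W.map _ = W.map _
    rw [← hg, ← hg]
    have := hW _ (QuotientGroup.eq.1 h)
    rw [map_mul, map_inv, RelIso.mul_apply] at this
    conv_lhs => rw [← this]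
    exact RelIso.apply_inv_self _ _
  have hle := Nat.card_le_card_of_injective _ hinj
  rw [← Subgroup.index_eq_card, natCard_eq_pow_finrank (K := F), finrank_linearMap] at hle
  refine le_trans ?_ hle
  have hF : 2 ≤ Nat.card F := Finite.one_lt_card
  have hsum : finrank F W + finrank F U = n := by
    rw [Submodule.finrank_add_eq_of_isCompl hU, finrank_fin_fun]
  have h1 : finrank F W ≠ 0 := fun h => hbot (Submodule.finrank_eq_zero.1 h)
  have h2 : finrank F U ≠ 0 := fun h => htop <| by
    have := hU.sup_eq_top
    rwa [Submodule.finrank_eq_zero.1 h, sup_bot_eq] at this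
  have h3 : n - 1 ≤ finrank F W * finrank F U := by
    obtain ⟨a, ha⟩ := Nat.exists_eq_succ_of_ne_zero h1
    obtain ⟨b, hb⟩ := Nat.exists_eq_succ_of_ne_zero h2
    rw [ha, hb] at hsum ⊢
    have : (a + 1) * (b + 1) = a * b + a + b + 1 := by ring
    simp only [Nat.succ_eq_add_one] at *
    omega
  calc 2 ^ (n - 1) ≤ 2 ^ (finrank F W * finrank F U) := Nat.pow_le_pow_right two_pos h3
    _ ≤ _ := Nat.pow_le_pow_left hF _

theorem four_pow_le_index_sq [Finite F] {H : Subgroup (GL (Fin n) F)}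
    (hcl : IsClosedSubgroup (glAct n F) H) (hH : H ≠ ⊤) : 4 ^ (n - 1) ≤ H.index ^ 2 := by
  have : ∃ W ∈ invariants (glAct n F) H, W ≠ ⊥ ∧ W ≠ ⊤ := by
    by_contra! hno
    refine hH (eq_top_iff.2 fun g _ => (hcl.mem_iff _ g).2 fun W hW => ?_)
    by_cases hb : W = ⊥
    · rw [hb, map_bot]
    · rw [hno W hW hb, map_top]
  obtain ⟨W, hW, hb, ht⟩ := this
  have := Nat.pow_le_pow_left (two_pow_le_index hW hb ht) 2
  rwa [← pow_mul, mul_comm, pow_mul] at this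

/-- The invariant lattice of `H` is a product of chains whose steps have the dimensions
prescribed by `D`. -/
def HasChainData (H : Subgroup (GL (Fin n) F)) (D : ChainData) : Prop :=
  ∃ ψ : BoundedLatticeHom ((i : Fin D.1) → Fin ((D.2 i).1 + 1)) (Submodule F (Fin n → F)),
    (∀ W, W ∈ invariants (glAct n F) H ↔ ∃ x, ψ x = W) ∧
    ∀ i j, finrank F (ψ (Function.update ⊥ i j.castSucc)) + (D.2 i).2 j =
      finrank F (ψ (Function.update ⊥ i j.succ))

theorem exists_hasChainData {H : Subgroup (GL (Fin n) F)} {r : ℕ} {ℓ : Fin r → ℕ}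
    (φ : invariants (glAct n F) H ≃o ((i : Fin r) → Fin (ℓ i + 1))) :
    ∃ (D : ChainData) (t : ChainCode n), HasChainData H D ∧ t.Encodes D := by
  -- One-point chains would give zero blocks, which a composition forbids.
  obtain ⟨r', ℓ', hpos, ⟨θ⟩⟩ := exists_orderIso_pos ℓ
  let χ := (φ.trans θ).symm
  let ψ : BoundedLatticeHom ((i : Fin r') → Fin (ℓ' i + 1)) (Submodule F (Fin n → F)) :=
    { toFun := fun x => χ x
      map_sup' := fun x y => by rw [map_sup]; rfl
      map_inf' := fun x y => by rw [map_inf]; rfl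
      map_top' := by
        let T : invariants (glAct n F) H := ⟨⊤, fun _ _ => map_top _⟩
        have : T ≤ χ ⊤ := by
          rw [← χ.apply_symm_apply T]
          exact χ.monotone le_top
        exact top_le_iff.1 this
      map_bot' := by
        let B : invariants (glAct n F) H := ⟨⊥, fun _ _ => map_bot _⟩
        have : χ ⊥ ≤ B := by
          rw [← χ.apply_symm_apply B]
          exact χ.monotone bot_le
        exact le_bot_iff.1 this }
  have hψ : StrictMono ψ := χ.strictMono
  have hlt : ∀ i (j : Fin (ℓ' i)), finrank F (ψ (Function.update ⊥ i j.castSucc)) <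
      finrank F (ψ (Function.update ⊥ i j.succ)) := fun i j =>
    Submodule.finrank_lt_finrank_of_lt (hψ (update_lt_update_iff.2 Fin.castSucc_lt_succ))
  let d : (i : Fin r') → Fin (ℓ' i) → ℕ := fun i j =>
    finrank F (ψ (Function.update ⊥ i j.succ)) - finrank F (ψ (Function.update ⊥ i j.castSucc))
  have hd : ∀ i j, finrank F (ψ (Function.update ⊥ i j.castSucc)) + d i j =
      finrank F (ψ (Function.update ⊥ i j.succ)) := fun i j =>
    Nat.add_sub_of_le (hlt i j).le
  let D : ChainData := ⟨r', fun i => ⟨ℓ' i, d i⟩⟩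
  obtain ⟨t, ht⟩ := exists_encodes (n := n) D
    (by rw [← finrank_fin_fun F (n := n)]; exact (finrank_eq_sum_sum ψ hd).symm) hpos
    fun i j => Nat.sub_pos_of_lt (hlt i j)
  refine ⟨D, t, ⟨ψ, fun W => ⟨fun hW => ?_, ?_⟩, hd⟩, ht⟩
  · exact ⟨χ.symm ⟨W, hW⟩, congrArg Subtype.val (χ.apply_symm_apply ⟨W, hW⟩)⟩
  · rintro ⟨x, rfl⟩
    exact (χ x).2

theorem HasChainData.exists_conj {H K : Subgroup (GL (Fin n) F)} {D : ChainData}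
    (hH : HasChainData H D) (hK : HasChainData K D) (hHcl : IsClosedSubgroup (glAct n F) H)
    (hKcl : IsClosedSubgroup (glAct n F) K) :
    ∃ g, H.map (MulAut.conj g).toMonoidHom = K := by
  obtain ⟨ψ, hψ, hd⟩ := hH
  obtain ⟨ψ', hψ', hd'⟩ := hK
  obtain ⟨e, he⟩ := exists_linearEquiv_map_eq ψ ψ' hd hd'
  obtain ⟨g, hg⟩ := exists_glAct_eq_map e
  refine ⟨g, hHcl.map_conj_eq _ hKcl g fun W => ?_⟩
  rw [hψ, hψ']
  refine exists_congr fun x => ?_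
  rw [← he, ← hg, (glAct n F g).injective.eq_iff]

theorem c_glAct_le [Finite F] (m : ℕ) : c (glAct n F) m ≤ m ^ 3 := by
  classical
  set S := closedProductOfChains (glAct n F) m with hS
  rcases S.eq_empty_or_nonempty with h0 | ⟨H₀, hH₀⟩
  · rw [c, ← hS, h0, Set.ncard_empty]
    exact Nat.zero_le _
  -- The lower bound on the index fails for `H = ⊤`, so index 1 is treated apart.
  by_cases hm : m = 1
  · subst hm
    have : S ⊆ {⊤} := fun H hH => Subgroup.index_eq_one.1 hH.2.1
    have := Set.ncard_le_ncard this (Set.toFinite _)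
    rwa [Set.ncard_singleton] at this
  have hm2 : 4 ^ (n - 1) ≤ m ^ 2 := by
    have := four_pow_le_index_sq hH₀.1 fun h => hm (by rw [← hH₀.2.1, h, Subgroup.index_top])
    rwa [hH₀.2.1] at this
  have hcode : ∀ H ∈ S, ∃ t : ChainCode n, ∃ D, HasChainData H D ∧ t.Encodes D := by
    rintro H ⟨_, _, r, ℓ, ⟨φ⟩⟩
    obtain ⟨D, t, h, ht⟩ := exists_hasChainData φ
    exact ⟨t, D, h, ht⟩
  have : Nonempty (ChainCode n) := ⟨(hcode H₀ hH₀).choose⟩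
  choose! τ hτ using hcode
  have hfib : ∀ t, {H ∈ S | τ H = t}.ncard ≤ m := by
    intro t
    rcases Set.eq_empty_or_nonempty {H ∈ S | τ H = t} with h | ⟨H, hH, rfl⟩
    · rw [h, Set.ncard_empty]
      exact Nat.zero_le _
    rw [← hH.2.1]
    refine ncard_conjugates_le_index H _ ?_
    rintro K ⟨hK, hKt⟩
    obtain ⟨D, hD, hDt⟩ := hτ H hH
    obtain ⟨D', hD', hDt'⟩ := hτ K hK
    rw [hKt] at hDt'
    obtain rfl := hDt.unique hDt'
    exact hD.exists_conj hD' hH.1 hK.1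
  have hfin : S.Finite := Set.toFinite S
  have hcard : c (glAct n F) m ≤ m * Fintype.card (ChainCode n) := by
    rw [c, ← hS, Set.ncard_eq_toFinset_card S hfin]
    refine (Finset.card_le_mul_card_image (f := τ) hfin.toFinset m fun t _ => ?_).trans
      (Nat.mul_le_mul_left m (Finset.card_le_univ _))
    rw [← Set.ncard_coe_finset]
    simpa using hfib t
  calc c (glAct n F) m ≤ m * Fintype.card (ChainCode n) := hcard
    _ ≤ m * m ^ 2 := Nat.mul_le_mul_left m ((card_chainCode_le n).trans hm2)
    _ = m ^ 3 := by ring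

end ClosedSubgroups

theorem theorem1p2 :
    ∃ α : ℕ, α ≤ 12 ∧
      ∀ (F : Type*) [Field F] [Finite F] (n m : ℕ),
        ClosedSubgroups.c (ClosedSubgroups.glAct n F) m ≤ m ^ α ∧
        ClosedSubgroups.c (ClosedSubgroups.pglAct n F) m ≤ m ^ α := by
  refine ⟨3, by norm_num, fun F _ _ n m => ⟨ClosedSubgroups.c_glAct_le m, ?_⟩⟩
  exact (ClosedSubgroups.c_le_of_comp _ Matrix.ProjGenLinGroup.mk
    Matrix.ProjGenLinGroup.mk_surjective _ ClosedSubgroups.pglAct_mk m).trans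
      (ClosedSubgroups.c_glAct_le m)
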